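/- Let $\mathcal C$ be a weakly abelian category, i.e. an additive category in which every morphism has a weak kernel and a weak cokernel, is a weak kernel of some morphism and is a weak cokernel of some morphism. Let $\hat{\mathcal C}$ be its Freyd category, i.e. the quotient of the category of arrows of $\mathcal C$ by the full subcategory of zero morphisms; regard $\mathcal C$ as a full subcategory of $\hat{\mathcal C}$ via $X\mapsto (X\xrightarrow{1}X)$. Here the quotient $\mathcal A/\mathcal B$ of an additive category by a full additive subcategory has the objects of $\mathcal A$, and two parallel morphisms are identified if their difference factors over an object of $\mathcal B$. A morphism of an additive category is called split if it is isomorphic, as an arrow, to a morphism of the form $\left(\begin{smallmatrix}0&0\\1&0\end{smallmatrix}\right): X\oplus Y\to Y\oplus Z$, that is, to the morphism that is the identity on the summand $Y$ and zero otherwise. For $n\ge 1$ let $\dot\Delta_n=\{1<2<\dots<n\}$ and, for a category $\mathcal A$, let $\mathcal A(\dot\Delta_n)$ be the category of functors $\dot\Delta_n\to\mathcal A$. Let $\mathcal C^{\mathrm{split}}(\dot\Delta_n)\subseteq\mathcal C(\dot\Delta_n)$ be the full subcategory of those $X$ for which all the morphisms $X_i\to X_j$ ($i\le j$) are split in $\hat{\mathcal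 C}$. Put $\underline{\mathcal C(\dot\Delta_n)}=\mathcal C(\dot\Delta_n)/\mathcal C^{\mathrm{split}}(\dot\Delta_n)$ and $\underline{\hat{\mathcal C}(\dot\Delta_{n})}=\hat{\mathcal C}(\dot\Delta_{n})/\mathcal C^{\mathrm{split}}(\dot\Delta_{n})$. Let $n\ge 2$ and let $K:\mathcal C(\dot\Delta_n)\to\hat{\mathcal C}(\dot\Delta_{n-1})$ be the functor with $(XK)_i=\operatorname{Ker}(X_i\to X_n)$, taken in $\hat{\mathcal C}$, for $1\le i\le n-1$, with the induced morphisms. Then $K$ induces an equivalence of categories $$\underline{\mathcal C(\dot\Delta_n)}\;\xrightarrow{\ \sim\ }\;\underline{\hat{\mathcal C}(\dot\Delta_{n-1})},\qquad X\mapsto XK .$$ In particular, for $n=2$, the functor $X\mapsto \operatorname{Ker}(X_1\to X_2)$ induces an equivalence $\underline{\mathcal C(\dot\Delta_2)}\xrightarrow{\sim}\hat{\mathcal C}/\mathcal C$, the quotient category with which Heller originally worked. -/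

import Mathlib

open CategoryTheory CategoryTheory.Limits

universe v u

noncomputable section

/-! ### Quotients of additive categories -/

section AddQuot

variable {A : Type u} [Category.{v} A] [Preadditive A]

/-- Two parallel morphisms are equivalent modulo `P` if their difference factors over an object
satisfying `P`. -/
def factorRel (P : ObjectProperty A) : HomRel A := fun X Y f g =>
  ∃ (Z : A) (_ : P Z) (a : X ⟶ Z) (b : Z ⟶ Y), f - g = a ≫ b

/-- The quotient `A / P` of the additive category `A` by the full subcategory `P`: same objects,
morphisms modulo those that factor over an object satisfying `P` (it is used only for `P` that
contain zero and are closed under direct sums, where `factorRel P` is a congruence). -/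
abbrev AddQuot (P : ObjectProperty A) := CategoryTheory.Quotient (factorRel P)

/-- The residue class functor `A ⥤ A / P`. -/
abbrev AddQuot.functor (P : ObjectProperty A) : A ⥤ AddQuot P :=
  CategoryTheory.Quotient.functor (factorRel P)

/-- A functor `F : A ⥤ B` induces an equivalence `A / P ⥤ B / Q`: it descends to the quotients,
and the functor it induces there is an equivalence of categories. -/
def InducesEquivalence {B : Type*} [Category* B] [Preadditive B] (F : A ⥤ B)
    (P : ObjectProperty A) (Q : ObjectProperty B) : Prop :=
  ∃ G : AddQuot P ⥤ AddQuot Q,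
    AddQuot.functor P ⋙ G = F ⋙ AddQuot.functor Q ∧ G.IsEquivalence

/-- A morphism `f` of an additive category is split if, in the category of arrows, it is isomorphic
to `X ⊞ Y ⟶ Y ⊞ Z` for some `X`, `Y`, `Z`, the morphism that is the identity of `Y` on the
summand `Y` and zero otherwise. -/
def IsSplitMorphism [HasBinaryBiproducts A] {V W : A} (f : V ⟶ W) : Prop :=
  ∃ X Y Z : A,
    Nonempty (Arrow.mk f ≅ Arrow.mk ((biprod.snd : X ⊞ Y ⟶ Y) ≫ (biprod.inl : Y ⟶ Y ⊞ Z)))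

end AddQuot

/-! ### Weakly abelian categories and their Freyd categories -/

section WeaklyAbelian

variable {C : Type u} [Category.{v} C] [Preadditive C]

/-- `i` is a weak kernel of `f`. -/
def IsWeakKernelOf {K X Y : C} (i : K ⟶ X) (f : X ⟶ Y) : Prop :=
  i ≫ f = 0 ∧ ∀ ⦃T : C⦄ (t : T ⟶ X), t ≫ f = 0 → ∃ t' : T ⟶ K, t' ≫ i = t

/-- `p` is a weak cokernel of `f`. -/
def IsWeakCokernelOf {X Y Q : C} (p : Y ⟶ Q) (f : X ⟶ Y) : Prop :=
  f ≫ p = 0 ∧ ∀ ⦃T : C⦄ (t : Y ⟶ T), f ≫ t = 0 → ∃ t' : Q ⟶ T, p ≫ t' = t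

end WeaklyAbelian

/-- A weakly abelian category: an additive category in which every morphism has a weak kernel and a
weak cokernel, is a weak kernel and is a weak cokernel. -/
class WeaklyAbelian (C : Type u) [Category.{v} C] [Preadditive C] : Prop where
  hasZeroObject : HasZeroObject C
  hasBinaryBiproducts : HasBinaryBiproducts C
  exists_weakKernel : ∀ {X Y : C} (f : X ⟶ Y), ∃ (K : C) (i : K ⟶ X), IsWeakKernelOf i f
  exists_weakCokernel : ∀ {X Y : C} (f : X ⟶ Y), ∃ (Q : C) (p : Y ⟶ Q), IsWeakCokernelOf p f
  isWeakKernel : ∀ {X Y : C} (f : X ⟶ Y), ∃ (Z : C) (g : Y ⟶ Z), IsWeakKernelOf f g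
  isWeakCokernel : ∀ {X Y : C} (f : X ⟶ Y), ∃ (W : C) (g : W ⟶ X), IsWeakCokernelOf f g

attribute [instance] WeaklyAbelian.hasZeroObject WeaklyAbelian.hasBinaryBiproducts

section FreydCat

variable (C : Type u) [Category.{v} C] [Preadditive C]

/-- The objects of the arrow category of `C` that are zero morphisms. -/
def zeroArrows : ObjectProperty (Arrow C) := fun f => f.hom = 0

/-- The Freyd category of `C`: the arrow category modulo the full subcategory of zero morphisms. -/
abbrev FreydCat := AddQuot (zeroArrows C)

variable {C}

lemma factorRel_zeroArrows_iff {f g : Arrow C} (a b : f ⟶ g) :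
    factorRel (zeroArrows C) a b ↔ a.left ≫ g.hom = b.left ≫ g.hom := by
  constructor
  · rintro ⟨Z, hZ, p, q, h⟩
    have h1 : a.left - b.left = p.left ≫ q.left := congrArg CommaMorphism.left h
    have h2 : p.left ≫ q.left ≫ g.hom = 0 := by
      have hq : q.left ≫ g.hom = Z.hom ≫ q.right := q.w
      rw [hq, show Z.hom = 0 from hZ]
      simp
    rw [← sub_eq_zero, ← Preadditive.sub_comp, h1, Category.assoc, h2]
  · intro h
    have h0 : (a.left - b.left) ≫ g.hom = 0 := by
      rw [Preadditive.sub_comp, h, sub_self]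
    have h1 : f.hom ≫ (a.right - b.right) = 0 := by
      rw [← h0]
      exact (a - b).w.symm
    refine ⟨Arrow.mk (0 : f.left ⟶ g.right), rfl,
      Arrow.homMk (𝟙 f.left) (a.right - b.right) (by simp [h1]),
      Arrow.homMk (a.left - b.left) (𝟙 g.right) (by simp [h0]), ?_⟩
    ext <;> simp

instance : Congruence (factorRel (zeroArrows C)) where
  equivalence :=
    { refl := fun a => (factorRel_zeroArrows_iff a a).2 rfl
      symm := fun {a b} h =>
        (factorRel_zeroArrows_iff b a).2 ((factorRel_zeroArrows_iff a b).1 h).symm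
      trans := fun {a b c} h h' => (factorRel_zeroArrows_iff a c).2
        (((factorRel_zeroArrows_iff a b).1 h).trans ((factorRel_zeroArrows_iff b c).1 h')) }
  comp_left := by
    intro X Y Z f g g' h
    rw [factorRel_zeroArrows_iff] at h ⊢
    rw [Arrow.comp_left, Arrow.comp_left, Category.assoc, Category.assoc, h]
  comp_right := by
    intro X Y Z f f' g h
    rw [factorRel_zeroArrows_iff] at h ⊢
    have hg : g.left ≫ Z.hom = Y.hom ≫ g.right := g.w
    simp only [Arrow.comp_left, Category.assoc, hg]
    rw [← Category.assoc, h, Category.assoc]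

lemma factorRel_zeroArrows_add ⦃X Y : Arrow C⦄ (f₁ f₂ g₁ g₂ : X ⟶ Y)
    (h : factorRel (zeroArrows C) f₁ f₂) (h' : factorRel (zeroArrows C) g₁ g₂) :
    factorRel (zeroArrows C) (f₁ + g₁) (f₂ + g₂) := by
  rw [factorRel_zeroArrows_iff] at *
  rw [Arrow.Hom.add_left, Arrow.Hom.add_left, Preadditive.add_comp, Preadditive.add_comp, h, h']

instance : Preadditive (FreydCat C) :=
  CategoryTheory.Quotient.preadditive _ factorRel_zeroArrows_add

instance : (AddQuot.functor (zeroArrows C)).Additive :=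
  CategoryTheory.Quotient.functor_additive _ factorRel_zeroArrows_add

lemma FreydCat.functor_map_eq_iff {f g : Arrow C} (a b : f ⟶ g) :
    (AddQuot.functor (zeroArrows C)).map a = (AddQuot.functor (zeroArrows C)).map b ↔
      a.left ≫ g.hom = b.left ≫ g.hom := by
  rw [CategoryTheory.Quotient.functor_map_eq_iff, factorRel_zeroArrows_iff]

variable (C) in
/-- The embedding of `C` into its Freyd category, sending `X` to the identity morphism of `X`. -/
def toFreyd : C ⥤ FreydCat C where
  obj X := (AddQuot.functor (zeroArrows C)).obj (Arrow.mk (𝟙 X))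
  map f := (AddQuot.functor (zeroArrows C)).map (Arrow.homMk f f (by simp))
  map_id X := by
    rw [← (AddQuot.functor (zeroArrows C)).map_id]
    rfl
  map_comp f g := by
    rw [← (AddQuot.functor (zeroArrows C)).map_comp]
    rfl

variable [WeaklyAbelian C]

instance : HasBinaryBiproducts (FreydCat C) where
  has_binary_biproduct X Y := by
    have : HasBinaryBiproducts (Arrow C) := HasBinaryBiproducts.of_hasBinaryProducts
    let F := AddQuot.functor (zeroArrows C)
    let b := F.mapBinaryBicone (BinaryBiproduct.bicone X.as Y.as)
    exact HasBinaryBiproduct.mk ⟨b, isBinaryBilimitOfTotal b (by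
      have h := congrArg F.map (biprod.total (X := X.as) (Y := Y.as))
      rw [F.map_add, F.map_comp, F.map_comp, F.map_id] at h
      exact h)⟩

/-- Kernels in the Freyd category: if `i` is a weak kernel of the diagonal of a representative
`x ⟶ y` of a morphism, then `i ≫ x`, together with `(i, 𝟙)`, is a kernel. -/
instance : HasKernels (FreydCat C) where
  has_limit {X Y} f := by
    obtain ⟨φ, rfl⟩ := (AddQuot.functor (zeroArrows C)).map_surjective f
    let x : Arrow C := X.as
    let y : Arrow C := Y.as
    let F := AddQuot.functor (zeroArrows C)
    obtain ⟨K, i, hi, hK⟩ := WeaklyAbelian.exists_weakKernel (φ.left ≫ y.hom)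
    let κ : Arrow.mk (i ≫ x.hom) ⟶ x := Arrow.homMk i (𝟙 _) (by simp)
    have hw : F.map κ ≫ F.map φ = 0 := by
      rw [← F.map_comp, ← F.map_zero, FreydCat.functor_map_eq_iff]
      rw [Arrow.comp_left, Arrow.Hom.zero_left, zero_comp, Category.assoc]
      exact hi
    have : Mono (F.map κ) := by
      refine Preadditive.mono_of_cancel_zero _ fun {T} t ht => ?_
      obtain ⟨τ, rfl⟩ := F.map_surjective (X := T.as) (Y := Arrow.mk (i ≫ x.hom)) t
      rw [← F.map_comp, ← F.map_zero, FreydCat.functor_map_eq_iff] at ht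
      rw [← F.map_zero, FreydCat.functor_map_eq_iff]
      simpa [κ] using ht
    refine ⟨⟨⟨_, KernelFork.IsLimit.ofι' (F.map κ) hw fun {T} t ht => ?_⟩⟩⟩
    apply Classical.choice
    obtain ⟨τ, rfl⟩ := F.map_surjective (X := T.as) (Y := x) t
    rw [← F.map_comp, ← F.map_zero, FreydCat.functor_map_eq_iff] at ht
    obtain ⟨u, hu⟩ := hK τ.left (by
      simpa only [Arrow.comp_left, Arrow.Hom.zero_left, zero_comp, Category.assoc] using ht)
    have hτ : τ.left ≫ x.hom = T.as.hom ≫ τ.right := τ.w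
    refine ⟨F.map (Arrow.homMk u τ.right ?_), ?_⟩
    · rw [← hτ, ← hu]
      simp
    · rw [← F.map_comp]
      congr 1
      ext <;> simp [κ, hu]

end FreydCat

/-! ### Diagrams on finite linear orders -/

section Diagrams

variable (C : Type u) [Category.{v} C] [Preadditive C] [WeaklyAbelian C]

/-- The diagrams `X₁ ⟶ ⋯ ⟶ Xₙ` with entries in `C` all of whose morphisms `Xᵢ ⟶ Xⱼ`, `i ≤ j`,
are split in the Freyd category. -/
def splitDiagrams (n : ℕ) : ObjectProperty (Fin n ⥤ C) := fun X =>
  ∀ ⦃i j : Fin n⦄ (h : i ⟶ j), IsSplitMorphism ((toFreyd C).map (X.map h))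

/-- The split diagrams with entries in `C`, as diagrams in the Freyd category. -/
def splitDiagramsInFreyd (n : ℕ) : ObjectProperty (Fin n ⥤ FreydCat C) :=
  (splitDiagrams C n).map ((Functor.whiskeringRight _ _ _).obj (toFreyd C))

/-- The functor `K`: it sends a diagram `X₀ ⟶ ⋯ ⟶ Xₘ` with entries in `C` to the diagram of the
kernels of `Xᵢ ⟶ Xₘ`, `i < m`, taken in the Freyd category, with the induced morphisms. -/
def lastKernels (m : ℕ) : (Fin (m + 1) ⥤ C) ⥤ (Fin m ⥤ FreydCat C) where
  obj X :=
    { obj := fun i => kernel ((toFreyd C).map (X.map (homOfLE (Fin.le_last i.castSucc))))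
      map := fun {i j} h => kernel.map _ _
        ((toFreyd C).map (X.map (homOfLE (Fin.castSucc_le_castSucc_iff.2 (leOfHom h))))) (𝟙 _) (by
          rw [Category.comp_id, ← Functor.map_comp, ← Functor.map_comp]
          rfl)
      map_id := fun i => by
        simp
      map_comp := fun {i j k} f g => by
        rw [← cancel_mono (kernel.ι _)]
        simp [← Functor.map_comp] }
  map {X Y} f :=
    { app := fun i => kernel.map _ _ ((toFreyd C).map (f.app i.castSucc))
        ((toFreyd C).map (f.app (Fin.last m))) (by
          rw [← Functor.map_comp, ← Functor.map_comp, f.naturality])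
      naturality := fun i j h => by
        simp [← cancel_mono (kernel.ι _), ← Functor.map_comp] }
  map_id X := by
    ext i
    simp
  map_comp f g := by
    ext i
    simp

end Diagrams

end

/-!
The full embedding of `C` into its Freyd category enters the argument through two facts: every object
of the Freyd category is a kernel of a morphism of `C`, formed there
(`FreydCat.exists_isWeakKernelOf_ι`), and the objects of `C` are injective there. Hence
(`IsWeakKernelOf.exists_comp_eq`) a morphism `X ⟶ W` of `C` that vanishes on the kernel
of `r : X ⟶ Y` factors over `r`.

Before passing to quotients, the functor `K = lastKernels C m` is already full and dense.

* Full: a morphism `K X ⟶ K Y` extends to a family `Xᵢ ⟶ Yᵢ` by injectivity. The deviation of this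
  family from naturality vanishes on the kernels, so it factors over the morphisms `Xᵢ ⟶ Xₘ`, and it
  can be removed by adding morphisms that factor over `Xᵢ ⟶ Xₘ` and hence do not change the morphism
  induced on kernels (`exists_hom_app_eq_add`).
* Dense: if `Yᵢ` is the kernel of `Eᵢ ⟶ Fᵢ`, take `Xᵢ = Eᵢ ⊞ Fᵢ₋₁ ⊞ ⋯ ⊞ F₀` and let the last object be
  the sum of all `Fᵢ` (`exists_diagram_isWeakKernelOf`).

Given this, three facts about split diagrams suffice (`inducesEquivalence_of_full_of_essSurj`).

* A morphism `f : X ⟶ Y` with `K f = 0` has components that factor over `Xᵢ ⟶ Xₘ`. Therefore `f`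
  factors over the diagram `Y₀ ⟶ Y₀ ⊞ Y₁ ⟶ ⋯` of split monomorphisms
  (`exists_factorization_isSplitMono`).
* If `Z` is split, the generalized inverses of the morphisms `Zᵢ ⟶ Zₘ` can be chosen compatibly
  (`exists_compatible_regular_inverse`), so that `K Z` is a direct summand of the split diagram
  `Z₀ ⟶ ⋯ ⟶ Zₘ₋₁`. Idempotents need not split in `C`, so `K Z` itself need not have entries in `C`.
* A split diagram is `K` of its extension by zero, which is split again
  (`exists_splitDiagrams_lastKernels_iso`).
-/

noncomputable section

/-! ### Equivalences between quotients of additive categories -/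

section AddQuot

variable {A : Type*} [Category* A] [Preadditive A] {B : Type*} [Category* B] [Preadditive B]

/-- A criterion for a full and dense additive functor to induce an equivalence on quotients.
Neither `P` nor `Q` has to be closed under direct sums: since `F` is full, a chain of elementary
identifications modulo `Q` lifts to a chain of identifications modulo `P`. -/
theorem inducesEquivalence_of_full_of_essSurj (F : A ⥤ B) [F.Additive] [F.Full] [F.EssSurj]
    (P : ObjectProperty A) (Q : ObjectProperty B)
    (hker : ∀ ⦃X Y : A⦄ (f : X ⟶ Y), F.map f = 0 →
      ∃ (Z : A) (_ : P Z) (a : X ⟶ Z) (b : Z ⟶ Y), f = a ≫ b)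
    (hPQ : ∀ ⦃Z : A⦄, P Z → ∃ (W : B) (_ : Q W) (a : F.obj Z ⟶ W) (b : W ⟶ F.obj Z), a ≫ b = 𝟙 _)
    (hQP : ∀ ⦃W : B⦄, Q W → ∃ (Z : A) (_ : P Z), Nonempty (F.obj Z ≅ W)) :
    InducesEquivalence F P Q := by
  have hlift : ∀ (X Y : A) (f g : X ⟶ Y), factorRel P f g →
      (F ⋙ AddQuot.functor Q).map f = (F ⋙ AddQuot.functor Q).map g := by
    rintro X Y f g ⟨Z, hZ, a, b, h⟩
    obtain ⟨W, hW, c, d, hcd⟩ := hPQ hZ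
    refine CategoryTheory.Quotient.sound _ ⟨W, hW, F.map a ≫ c, d ≫ F.map b, ?_⟩
    rw [← F.map_sub, h, F.map_comp, Category.assoc, reassoc_of% hcd]
  -- Morphisms with the same image under `F` are identified modulo `P`.
  have hsame : ∀ {X Y : A} (f g : X ⟶ Y), F.map f = F.map g →
      (AddQuot.functor P).map f = (AddQuot.functor P).map g := by
    intro X Y f g h
    obtain ⟨Z, hZ, a, b, hab⟩ := hker (f - g) (by rw [F.map_sub, h, sub_self])
    exact CategoryTheory.Quotient.sound _ ⟨Z, hZ, a, b, hab⟩
  have hrel : ∀ {X Y : A} (f g : X ⟶ Y), HomRel.CompClosure (factorRel Q) (F.map f) (F.map g) →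
      (AddQuot.functor P).map f = (AddQuot.functor P).map g := by
    intro X Y f g h
    obtain ⟨W, hW, p, q, hpq⟩ : factorRel Q (F.map f) (F.map g) := by
      generalize F.map f = f' at h
      generalize F.map g = g' at h
      obtain ⟨a, b, f, m₁, m₂, g, ⟨W, hW, p, q, hm⟩⟩ := h
      exact ⟨W, hW, f ≫ p, q ≫ g, by
        rw [← Preadditive.comp_sub, ← Preadditive.sub_comp, hm]; simp⟩
    obtain ⟨Z, hZ, ⟨e⟩⟩ := hQP hW
    let a := F.preimage (p ≫ e.inv)
    let b := F.preimage (e.hom ≫ q)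
    have h1 : (AddQuot.functor P).map f = (AddQuot.functor P).map (g + a ≫ b) := by
      refine hsame _ _ ?_
      rw [F.map_add, F.map_comp, F.map_preimage, F.map_preimage, Category.assoc,
        e.inv_hom_id_assoc, ← hpq, add_sub_cancel]
    rw [h1]
    exact CategoryTheory.Quotient.sound _ ⟨Z, hZ, a, b, by simp⟩
  have hgen : ∀ {X Y : A} (f' g' : F.obj X ⟶ F.obj Y),
      Relation.EqvGen (@HomRel.CompClosure B _ (factorRel Q) (F.obj X) (F.obj Y)) f' g' →
      ∀ f g : X ⟶ Y, F.map f = f' → F.map g = g' →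
        (AddQuot.functor P).map f = (AddQuot.functor P).map g := by
    intro X Y f' g' h
    induction h with
    | rel f' g' h =>
      rintro f g rfl rfl
      exact hrel f g h
    | refl f' =>
      rintro f g hf hg
      exact hsame f g (hf.trans hg.symm)
    | symm f' g' _ ih => exact fun f g hf hg => (ih g f hg hf).symm
    | trans f' k' g' _ _ ih₁ ih₂ =>
      exact fun f g hf hg => (ih₁ f (F.preimage k') hf (F.map_preimage _)).trans
        (ih₂ (F.preimage k') g (F.map_preimage _) hg)
  let G : AddQuot P ⥤ AddQuot Q := CategoryTheory.Quotient.lift _ (F ⋙ AddQuot.functor Q) hlift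
  have hG : AddQuot.functor P ⋙ G = F ⋙ AddQuot.functor Q :=
    CategoryTheory.Quotient.lift_spec _ _ _
  refine ⟨G, hG, ?_⟩
  have : G.Full := ⟨fun {X Y} f => by
    obtain ⟨f, rfl⟩ := (AddQuot.functor Q).map_surjective (X := F.obj X.as) (Y := F.obj Y.as) f
    obtain ⟨f, rfl⟩ := F.map_surjective f
    exact ⟨(AddQuot.functor P).map f, rfl⟩⟩
  have : G.Faithful := ⟨fun {X Y f g} h => by
    obtain ⟨f, rfl⟩ := (AddQuot.functor P).map_surjective (X := X.as) (Y := Y.as) f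
    obtain ⟨g, rfl⟩ := (AddQuot.functor P).map_surjective (X := X.as) (Y := Y.as) g
    exact hgen _ _ (Quot.eqvGen_exact h) f g rfl rfl⟩
  have : G.EssSurj := ⟨fun Y =>
    ⟨(AddQuot.functor P).obj (F.objPreimage Y.as),
      ⟨(AddQuot.functor Q).mapIso (F.objObjPreimageIso Y.as)⟩⟩⟩
  exact { }

end AddQuot

/-! ### Split morphisms -/

section Split

open scoped ZeroObject

variable {A : Type*} [Category* A] [Preadditive A] [HasBinaryBiproducts A]

lemma IsSplitMorphism.of_arrow_iso {V W V' W' : A} {f : V ⟶ W} {g : V' ⟶ W'}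
    (hf : IsSplitMorphism f) (e : Arrow.mk f ≅ Arrow.mk g) : IsSplitMorphism g := by
  obtain ⟨X, Y, Z, ⟨i⟩⟩ := hf
  exact ⟨X, Y, Z, ⟨e.symm ≪≫ i⟩⟩

/-- A split morphism is von Neumann regular. -/
lemma IsSplitMorphism.exists_comp_comp_eq {V W : A} {f : V ⟶ W} (hf : IsSplitMorphism f) :
    ∃ s : W ⟶ V, f ≫ s ≫ f = f := by
  obtain ⟨X, Y, Z, ⟨e⟩⟩ := hf
  have h1 : e.hom.left ≫ biprod.snd ≫ biprod.inl = f ≫ e.hom.right := e.hom.w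
  have h2 : e.inv.left ≫ f = biprod.snd ≫ biprod.inl ≫ e.inv.right := by
    simp
  have h3 : e.hom.left ≫ e.inv.left = 𝟙 _ := by
    rw [← Arrow.comp_left, e.hom_inv_id]; rfl
  have h4 : e.hom.right ≫ e.inv.right = 𝟙 _ := by
    rw [← Arrow.comp_right, e.hom_inv_id]; rfl
  refine ⟨e.hom.right ≫ (biprod.fst ≫ biprod.inr) ≫ e.inv.left, ?_⟩
  simp only [Category.assoc, h2]
  rw [← reassoc_of% h1]
  simp only [biprod.inl_fst_assoc, biprod.inr_snd_assoc]
  rw [reassoc_of% h1]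
  erw [h4, Category.comp_id]

lemma IsSplitMorphism.of_isSplitMono [HasZeroObject A] [HasKernels A] {V W : A} (f : V ⟶ W)
    [IsSplitMono f] : IsSplitMorphism f := by
  let q := retraction f
  have hq : f ≫ q = 𝟙 V := IsSplitMono.id f
  -- The other summand of `W` is the kernel of the retraction.
  let p : W ⟶ kernel q := kernel.lift q (𝟙 W - q ≫ f) (by simp [hq])
  have hp : p ≫ kernel.ι q = 𝟙 W - q ≫ f := kernel.lift_ι _ _ _
  have hfp : f ≫ p = 0 := by
    rw [← cancel_mono (kernel.ι q), Category.assoc, hp]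
    simp [reassoc_of% hq]
  have hip : kernel.ι q ≫ p = 𝟙 _ := by
    rw [← cancel_mono (kernel.ι q), Category.assoc, hp]
    simp
  let e : W ≅ V ⊞ kernel q :=
    { hom := biprod.lift q p
      inv := biprod.desc f (kernel.ι q)
      hom_inv_id := by rw [biprod.lift_desc, hp, add_sub_cancel]
      inv_hom_id := by ext <;> simp [hq, hfp, hip] }
  have he : f ≫ e.hom = biprod.inl := by
    ext <;> simp [e, hq, hfp]
  refine ⟨0, V, kernel q, ⟨Arrow.isoMk (isoZeroBiprod (isZero_zero A)) e ?_⟩⟩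
  simp [he, isoZeroBiprod]

lemma IsSplitMorphism.of_isZero [HasZeroObject A] {V W : A} (f : V ⟶ W) (hW : IsZero W) :
    IsSplitMorphism f :=
  have h : IsZero ((0 : A) ⊞ (0 : A)) := by
    refine (IsZero.iff_id_eq_zero _).2 (biprod.hom_ext _ _ ?_ ?_) <;>
    exact (isZero_zero A).eq_of_tgt _ _
  ⟨V, 0, 0, ⟨Arrow.isoMk (isoBiprodZero (isZero_zero A)) (hW.iso h) (h.eq_of_tgt _ _)⟩⟩

end Split

/-! ### Bijective objects of the Freyd category -/

section Freyd

open scoped ZeroObject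

variable {C : Type u} [Category.{v} C] [Preadditive C]

lemma toFreyd_map_eq_iff {X Y : C} (f g : X ⟶ Y) :
    (toFreyd C).map f = (toFreyd C).map g ↔ f = g := by
  refine (FreydCat.functor_map_eq_iff _ _).trans ?_
  simp

instance : (toFreyd C).Faithful := ⟨fun h => (toFreyd_map_eq_iff _ _).1 h⟩

instance : (toFreyd C).Full := ⟨fun {X Y} f => by
  obtain ⟨φ, rfl⟩ := (AddQuot.functor (zeroArrows C)).map_surjective
    (X := Arrow.mk (𝟙 X)) (Y := Arrow.mk (𝟙 Y)) f
  exact ⟨φ.left, (FreydCat.functor_map_eq_iff _ _).2 (by simp)⟩⟩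

instance : (toFreyd C).Additive := ⟨fun {X Y f g} => by
  refine Eq.trans ?_ ((AddQuot.functor (zeroArrows C)).map_add)
  exact (FreydCat.functor_map_eq_iff _ _).2 (by simp)⟩

/-- The embedding of the object `A ⟶ B` of the Freyd category, which is the image of the morphism
it represents, into the object `B` of `C`. -/
def FreydCat.ι (Y : FreydCat C) : Y ⟶ (toFreyd C).obj Y.as.right :=
  (AddQuot.functor (zeroArrows C)).map (X := Y.as) (Y := Arrow.mk (𝟙 Y.as.right))
    (Arrow.homMk Y.as.hom (𝟙 _) (by simp))

instance (Y : FreydCat C) : Mono (FreydCat.ι Y) := by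
  refine Preadditive.mono_of_cancel_zero _ fun {T} t ht => ?_
  obtain ⟨τ, rfl⟩ := (AddQuot.functor (zeroArrows C)).map_surjective (X := T.as) (Y := Y.as) t
  have ht' := (FreydCat.functor_map_eq_iff (τ ≫ _) 0).1
    (((AddQuot.functor (zeroArrows C)).map_comp _ _).trans
      (ht.trans ((AddQuot.functor (zeroArrows C)).map_zero T.as _).symm))
  exact ((FreydCat.functor_map_eq_iff τ 0).2 (by simpa using ht')).trans
    ((AddQuot.functor (zeroArrows C)).map_zero _ _)

variable [WeaklyAbelian C]

instance : HasZeroObject (FreydCat C) :=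
  ⟨⟨(toFreyd C).obj 0, (toFreyd C).map_isZero (isZero_zero C)⟩⟩

/-- Every object of the Freyd category is a kernel of a morphism of `C`. -/
lemma FreydCat.exists_isWeakKernelOf_ι (Y : FreydCat C) :
    ∃ (Z : C) (w : Y.as.right ⟶ Z), IsWeakKernelOf (FreydCat.ι Y) ((toFreyd C).map w) := by
  obtain ⟨Z, w, hw, h⟩ := WeaklyAbelian.isWeakKernel Y.as.hom
  refine ⟨Z, w, ?_, fun T t ht => ?_⟩
  · refine (((AddQuot.functor (zeroArrows C)).map_comp _ _).symm.trans
      ((FreydCat.functor_map_eq_iff _ 0).2 ?_)).trans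
        ((AddQuot.functor (zeroArrows C)).map_zero Y.as _)
    simpa using hw
  · obtain ⟨τ, rfl⟩ := (AddQuot.functor (zeroArrows C)).map_surjective (X := T.as)
      (Y := Arrow.mk (𝟙 Y.as.right)) t
    have ht' := (FreydCat.functor_map_eq_iff (τ ≫ _) 0).1
      (((AddQuot.functor (zeroArrows C)).map_comp _ _).trans
        (ht.trans ((AddQuot.functor (zeroArrows C)).map_zero T.as _).symm))
    obtain ⟨s, hs⟩ := h τ.left (by simpa using ht')
    have hτ : τ.left ≫ 𝟙 _ = T.as.hom ≫ τ.right := τ.w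
    refine ⟨(AddQuot.functor (zeroArrows C)).map (X := T.as) (Y := Y.as)
      (Arrow.homMk s τ.right (by rw [hs]; simpa using hτ)),
      ((AddQuot.functor (zeroArrows C)).map_comp _ _).symm.trans
        ((FreydCat.functor_map_eq_iff _ _).2 ?_)⟩
    simpa using hs

/-- The objects of `C` are injective in the Freyd category. -/
instance (W : C) : Injective ((toFreyd C).obj W) where
  factors {Y Z} g j _ := by
    obtain ⟨γ, rfl⟩ := (AddQuot.functor (zeroArrows C)).map_surjective (X := Y.as)
      (Y := Arrow.mk (𝟙 W)) g
    obtain ⟨φ, rfl⟩ := (AddQuot.functor (zeroArrows C)).map_surjective (X := Y.as)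
      (Y := Z.as) j
    have hγ : γ.left ≫ 𝟙 _ = Y.as.hom ≫ γ.right := γ.w
    obtain ⟨V, k, hk, h⟩ := WeaklyAbelian.isWeakCokernel (φ.left ≫ Z.as.hom)
    -- As `φ` is a monomorphism, `k` is annihilated by `Y.as.hom` as well.
    have hk' : k ≫ Y.as.hom = 0 := by
      let κ : Arrow.mk (𝟙 V) ⟶ Y.as := Arrow.homMk k (k ≫ Y.as.hom)
      have h0 : (AddQuot.functor (zeroArrows C)).map κ =
          (AddQuot.functor (zeroArrows C)).map 0 := by
        rw [← cancel_mono ((AddQuot.functor (zeroArrows C)).map φ)]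
        refine (((AddQuot.functor (zeroArrows C)).map_comp _ _).symm.trans
          ((FreydCat.functor_map_eq_iff _ _).2 ?_)).trans
            ((AddQuot.functor (zeroArrows C)).map_comp _ _)
        simpa [κ] using hk
      simpa [κ] using (FreydCat.functor_map_eq_iff _ _).1 h0
    obtain ⟨w, hw⟩ := h (Y.as.hom ≫ γ.right) (by rw [reassoc_of% hk', zero_comp])
    refine ⟨(AddQuot.functor (zeroArrows C)).map (X := Z.as) (Y := Arrow.mk (𝟙 W))
      (Arrow.homMk (Z.as.hom ≫ w) w (by simp)),
      ((AddQuot.functor (zeroArrows C)).map_comp _ _).symm.trans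
        ((FreydCat.functor_map_eq_iff _ _).2 ?_)⟩
    simpa [(Category.comp_id γ.left).symm.trans hγ] using hw

/-- A morphism of `C` that vanishes on the kernel of `r`, formed in the Freyd category, factors
over `r` within `C`: its target is injective. -/
lemma IsWeakKernelOf.exists_comp_eq {K : FreydCat C} {X Y W : C} {κ : K ⟶ (toFreyd C).obj X}
    {r : X ⟶ Y} (hκ : IsWeakKernelOf κ ((toFreyd C).map r)) (δ : X ⟶ W)
    (hδ : κ ≫ (toFreyd C).map δ = 0) : ∃ d : Y ⟶ W, r ≫ d = δ := by
  obtain ⟨V, g, hg, h⟩ := WeaklyAbelian.isWeakCokernel r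
  refine h δ ((toFreyd C).map_injective ?_)
  obtain ⟨t, ht⟩ := hκ.2 ((toFreyd C).map g) (by rw [← Functor.map_comp, hg, Functor.map_zero])
  rw [Functor.map_comp, ← ht, Category.assoc, hδ, comp_zero, Functor.map_zero]

end Freyd

/-! ### Diagrams on finite linear orders -/

section LinearDiagrams

variable {D : Type*} [Category* D] {m : ℕ}

/-- The morphism `Xᵢ ⟶ Xₘ` to the last object of a diagram `X₀ ⟶ ⋯ ⟶ Xₘ`. -/
abbrev toLast (X : Fin (m + 1) ⥤ D) (i : Fin (m + 1)) : X.obj i ⟶ X.obj (Fin.last m) :=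
  X.map (homOfLE (Fin.le_last i))

/-- The morphism `Xᵢ ⟶ Xᵢ₊₁` in a diagram `X₀ ⟶ ⋯ ⟶ Xₘ`. -/
abbrev toSucc (X : Fin (m + 1) ⥤ D) (i : Fin m) : X.obj i.castSucc ⟶ X.obj i.succ :=
  X.map (homOfLE i.castSucc_le_succ)

lemma toSucc_toLast (X : Fin (m + 1) ⥤ D) (i : Fin m) :
    toSucc X i ≫ toLast X i.succ = toLast X i.castSucc := by
  rw [← X.map_comp]
  rfl

lemma toSucc_toLast_assoc (X : Fin (m + 1) ⥤ D) (i : Fin m) {T : D}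
    (h : X.obj (Fin.last m) ⟶ T) :
    toSucc X i ≫ toLast X i.succ ≫ h = toLast X i.castSucc ≫ h := by
  rw [← Category.assoc, toSucc_toLast]

lemma toLast_last (X : Fin (m + 1) ⥤ D) : toLast X (Fin.last m) = 𝟙 _ :=
  X.map_id _

/-- A morphism of linear diagrams, from its components and the commutation of the squares given by
consecutive objects. -/
def linearHom {X Y : Fin (m + 1) ⥤ D} (app : ∀ i, X.obj i ⟶ Y.obj i)
    (w : ∀ i : Fin m, toSucc X i ≫ app i.succ = app i.castSucc ≫ toSucc Y i) : X ⟶ Y :=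
  ComposableArrows.homMk (F := X) (G := Y) app fun i hi => w ⟨i, hi⟩

@[simp]
lemma linearHom_app {X Y : Fin (m + 1) ⥤ D} (app : ∀ i, X.obj i ⟶ Y.obj i)
    (w : ∀ i : Fin m, toSucc X i ≫ app i.succ = app i.castSucc ≫ toSucc Y i) (i : Fin (m + 1)) :
    (linearHom app w).app i = app i := rfl

/-- A multiplicative property of morphisms holds for all morphisms of a linear diagram if it holds
for those between consecutive objects. -/
lemma linear_map_mem (W : MorphismProperty D) [W.IsMultiplicative] (X : Fin (m + 1) ⥤ D)
    (h : ∀ i : Fin m, W (toSucc X i)) {i j : Fin (m + 1)} (f : i ⟶ j) : W (X.map f) := by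
  induction j using Fin.induction with
  | zero =>
    obtain rfl : i = 0 := Fin.le_zero_iff.1 (leOfHom f)
    obtain rfl : f = 𝟙 _ := rfl
    rw [X.map_id]
    exact W.id_mem _
  | succ j ih =>
    rcases (leOfHom f).eq_or_lt with rfl | hlt
    · obtain rfl : f = 𝟙 _ := rfl
      rw [X.map_id]
      exact W.id_mem _
    · have hij : i ≤ j.castSucc := Fin.le_castSucc_iff.2 hlt
      obtain rfl : f = homOfLE hij ≫ homOfLE j.castSucc_le_succ := rfl
      rw [X.map_comp]
      exact W.comp_mem _ _ (ih _) (h j)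

variable [Preadditive D]

/-- A family of morphisms `Xᵢ ⟶ Yᵢ` that is natural up to morphisms factoring over `Xᵢ ⟶ Xₘ` can be
corrected, by morphisms factoring over `Xᵢ ⟶ Xₘ`, to a morphism of diagrams. -/
lemma exists_hom_app_eq_add {X Y : Fin (m + 1) ⥤ D} (φ : ∀ i, X.obj i ⟶ Y.obj i)
    (h : ∀ i : Fin m, ∃ e : X.obj (Fin.last m) ⟶ Y.obj i.succ,
      toLast X i.castSucc ≫ e = φ i.castSucc ≫ toSucc Y i - toSucc X i ≫ φ i.succ) :
    ∃ (f : X ⟶ Y) (d : ∀ i, X.obj (Fin.last m) ⟶ Y.obj i),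
      ∀ i, f.app i = φ i + toLast X i ≫ d i := by
  choose e he using h
  let d : ∀ i, X.obj (Fin.last m) ⟶ Y.obj i :=
    Fin.induction 0 fun i di => di ≫ toSucc Y i + e i
  have hd : ∀ i : Fin m, d i.succ = d i.castSucc ≫ toSucc Y i + e i := fun _ => rfl
  refine ⟨linearHom (fun i => φ i + toLast X i ≫ d i) fun i => ?_, d, fun i => rfl⟩
  rw [Preadditive.comp_add, toSucc_toLast_assoc, hd, Preadditive.comp_add, he,
    Preadditive.add_comp, Category.assoc]
  abel

/-- If all `Xᵢ ⟶ Xₘ` are von Neumann regular, their generalized inverses can be chosen such that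
they define a section of the morphism from `X` to the diagram of images in `Xₘ`. -/
lemma exists_compatible_regular_inverse (X : Fin (m + 1) ⥤ D)
    (h : ∀ i, ∃ s, toLast X i ≫ s ≫ toLast X i = toLast X i) :
    ∃ s : ∀ i, X.obj (Fin.last m) ⟶ X.obj i,
      (∀ i, toLast X i ≫ s i ≫ toLast X i = toLast X i) ∧
      ∀ i : Fin m, toLast X i.castSucc ≫ s i.castSucc ≫ toSucc X i =
        toLast X i.castSucc ≫ s i.succ := by
  choose σ hσ using h
  -- `s` is unchanged on the image of `Xᵢ` and given by `σ` on the complement of that image.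
  let s : ∀ i, X.obj (Fin.last m) ⟶ X.obj i :=
    Fin.induction (σ 0) fun i si =>
      si ≫ toSucc X i + (𝟙 _ - si ≫ toLast X i.castSucc) ≫ σ i.succ
  have hs : ∀ i : Fin m, s i.succ = s i.castSucc ≫ toSucc X i +
      (𝟙 _ - s i.castSucc ≫ toLast X i.castSucc) ≫ σ i.succ := fun _ => rfl
  have hreg : ∀ i, toLast X i ≫ s i ≫ toLast X i = toLast X i := by
    intro i
    induction i using Fin.induction with
    | zero => exact hσ 0
    | succ i ih =>
      have h1 := hσ i.succ
      have h2 := congrArg (fun z => toLast X i.succ ≫ s i.castSucc ≫ toSucc X i ≫ z) h1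
      simp only [toSucc_toLast, toSucc_toLast_assoc] at h2
      simp only [hs, Preadditive.add_comp, Preadditive.comp_add, Preadditive.sub_comp,
        Preadditive.comp_sub, Category.assoc, Category.id_comp, toSucc_toLast, h1, h2]
      abel
  refine ⟨s, hreg, fun i => ?_⟩
  rw [hs, Preadditive.comp_add, ← Category.assoc _ _ (σ i.succ), Preadditive.comp_sub,
    hreg, Category.comp_id, sub_self, zero_comp, add_zero]

/-- If each component of `f : X ⟶ Y` factors over `Xᵢ ⟶ Xₘ`, then `f` factors over a diagram of
split monomorphisms, namely over the diagram with objects `Y₀ ⊞ ⋯ ⊞ Yᵢ` and the inclusions. -/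
lemma exists_factorization_isSplitMono [HasBinaryBiproducts D] {X Y : Fin (m + 1) ⥤ D} (f : X ⟶ Y)
    (hf : ∀ i, ∃ h : X.obj (Fin.last m) ⟶ Y.obj i, toLast X i ≫ h = f.app i) :
    ∃ (Z : Fin (m + 1) ⥤ D) (a : X ⟶ Z) (b : Z ⟶ Y), f = a ≫ b ∧
      ∀ ⦃i j : Fin (m + 1)⦄ (g : i ⟶ j), IsSplitMono (Z.map g) := by
  choose h hh using hf
  let d : ∀ i : Fin m, X.obj (Fin.last m) ⟶ Y.obj i.succ := fun i =>
    h i.succ - h i.castSucc ≫ toSucc Y i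
  have hd : ∀ i, toLast X i.castSucc ≫ d i = 0 := fun i => by
    rw [Preadditive.comp_sub, ← Category.assoc, hh, ← f.naturality, ← hh i.succ,
      ← Category.assoc, toSucc_toLast, sub_self]
  -- The objects `Gᵢ = Y₀ ⊞ ⋯ ⊞ Yᵢ`, together with morphisms `Xₘ ⟶ Gᵢ ⟶ Yᵢ`.
  obtain ⟨G, p, q, ζ, hζ, hpq, hζq, hpζ⟩ : ∃ (G : Fin (m + 1) → D)
      (p : ∀ i, X.obj (Fin.last m) ⟶ G i) (q : ∀ i, G i ⟶ Y.obj i)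
      (ζ : ∀ i : Fin m, G i.castSucc ⟶ G i.succ), (∀ i, IsSplitMono (ζ i)) ∧
      (∀ i, p i ≫ q i = h i) ∧ (∀ i, ζ i ≫ q i.succ = q i.castSucc ≫ toSucc Y i) ∧
      (∀ i, toLast X i.castSucc ≫ p i.succ = (toLast X i.castSucc ≫ p i.castSucc) ≫ ζ i) := by
    let G : ∀ i : Fin (m + 1), Σ G : D, (X.obj (Fin.last m) ⟶ G) × (G ⟶ Y.obj i) :=
      Fin.induction ⟨Y.obj 0, h 0, 𝟙 _⟩ fun i G =>
        ⟨G.1 ⊞ Y.obj i.succ, biprod.lift G.2.1 (d i), biprod.desc (G.2.2 ≫ toSucc Y i) (𝟙 _)⟩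
    have h1 : ∀ (i : Fin m) (G : D) (p : X.obj (Fin.last m) ⟶ G) (q : G ⟶ Y.obj i.castSucc),
        p ≫ q = h i.castSucc →
        biprod.lift p (d i) ≫ biprod.desc (q ≫ toSucc Y i) (𝟙 _) = h i.succ := by
      intro i G p q hpq
      rw [biprod.lift_desc, ← Category.assoc, hpq, Category.comp_id, add_sub_cancel]
    have h2 : ∀ (i : Fin m) (G : D) (p : X.obj (Fin.last m) ⟶ G),
        toLast X i.castSucc ≫ biprod.lift p (d i) = (toLast X i.castSucc ≫ p) ≫ biprod.inl := by
      intro i G p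
      ext <;> simp [hd]
    refine ⟨fun i => (G i).1, fun i => (G i).2.1, fun i => (G i).2.2,
      fun i => (biprod.inl : (G i.castSucc).1 ⟶ (G i.castSucc).1 ⊞ Y.obj i.succ),
      fun i => (inferInstance : IsSplitMono (biprod.inl : (G i.castSucc).1 ⟶ _ ⊞ Y.obj i.succ)),
      fun i => ?_, fun i => biprod.inl_desc _ _, fun i => h2 i _ _⟩
    induction i using Fin.induction with
    | zero => exact Category.comp_id _
    | succ i ih => exact h1 i _ _ _ ih
  have hZ : ∀ i : Fin m, toSucc (ComposableArrows.mkOfObjOfMapSucc G ζ) i = ζ i :=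
    fun i => ComposableArrows.mkOfObjOfMapSucc_map_succ G ζ i.1 i.2
  let W : MorphismProperty D := fun _ _ g => IsSplitMono g
  have : W.IsMultiplicative :=
    { id_mem := fun _ => (inferInstance : IsSplitMono (𝟙 _))
      comp_mem := fun f g (_ : IsSplitMono f) (_ : IsSplitMono g) =>
        (inferInstance : IsSplitMono (f ≫ g)) }
  refine ⟨ComposableArrows.mkOfObjOfMapSucc G ζ,
    linearHom (fun i => toLast X i ≫ p i) fun i => ?_,
    linearHom q fun i => (congrArg (· ≫ q i.succ) (hZ i)).trans (hζq i), ?_,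
    fun i j g => linear_map_mem W _ (fun i => ?_) g⟩
  · exact (toSucc_toLast_assoc X i (p i.succ)).trans <| (hpζ i).trans <|
      (congrArg ((toLast X i.castSucc ≫ p i.castSucc) ≫ ·) (hZ i)).symm
  · ext i
    exact (hh i).symm.trans ((congrArg _ (hpq i).symm).trans (Category.assoc _ _ _).symm)
  · rw [hZ]
    exact hζ i

end LinearDiagrams

/-! ### Realizing a diagram of the Freyd category by kernels -/

section Density

open scoped ZeroObject

lemma precomp_map_zero_succ {D : Type*} [Category* D] {n : ℕ} (F : ComposableArrows D n) {X : D}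
    (f : X ⟶ F.left) (j : Fin (n + 1)) :
    (F.precomp f).map (homOfLE (Fin.zero_le j.succ)) = f ≫ F.map (homOfLE (Fin.zero_le j)) := by
  obtain ⟨_ | j, hj⟩ := j
  · exact (Category.comp_id f).symm.trans (congrArg (f ≫ ·) (F.map_id _).symm)
  · rfl

variable {C : Type u} [Category.{v} C] [Preadditive C] [WeaklyAbelian C]

lemma comp_toFreyd_map_biprod_lift {K : FreydCat C} {E U V : C} (κ : K ⟶ (toFreyd C).obj E)
    (a : E ⟶ U) (b : E ⟶ V) (hb : κ ≫ (toFreyd C).map b = 0) :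
    κ ≫ (toFreyd C).map (biprod.lift a b) =
      (κ ≫ (toFreyd C).map a) ≫ (toFreyd C).map biprod.inl := by
  rw [show biprod.lift a b = a ≫ biprod.inl + b ≫ biprod.inr by ext <;> simp,
    Functor.map_add, Preadditive.comp_add, Functor.map_comp, Functor.map_comp,
    reassoc_of% hb, zero_comp, add_zero, Category.assoc]

lemma IsWeakKernelOf.biprod_lift {K : FreydCat C} {E U V : C} {κ : K ⟶ (toFreyd C).obj E}
    {b : E ⟶ V} (h : IsWeakKernelOf κ ((toFreyd C).map b)) (a : E ⟶ U)
    (ha : κ ≫ (toFreyd C).map a = 0) :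
    IsWeakKernelOf κ ((toFreyd C).map (biprod.lift a b)) := by
  refine ⟨?_, fun T t ht => h.2 t ?_⟩
  · rw [comp_toFreyd_map_biprod_lift _ _ _ h.1, ha, zero_comp]
  · rw [← biprod.lift_snd a b, Functor.map_comp, ← Category.assoc, ht, zero_comp]

lemma IsWeakKernelOf.biprod_map_id {K : FreydCat C} {X Y : C} {κ : K ⟶ (toFreyd C).obj X}
    {r : X ⟶ Y} (h : IsWeakKernelOf κ ((toFreyd C).map r)) (F : C) :
    IsWeakKernelOf (κ ≫ (toFreyd C).map (biprod.inl : X ⟶ X ⊞ F))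
      ((toFreyd C).map (biprod.map r (𝟙 F))) := by
  refine ⟨?_, fun T t ht => ?_⟩
  · rw [Category.assoc, ← Functor.map_comp, biprod.inl_map, Functor.map_comp, ← Category.assoc,
      h.1, zero_comp]
  · have h1 := congrArg (· ≫ (toFreyd C).map biprod.fst) ht
    have h2 := congrArg (· ≫ (toFreyd C).map biprod.snd) ht
    simp only [Category.assoc, ← Functor.map_comp, biprod.map_fst, biprod.map_snd,
      zero_comp, Category.comp_id] at h1 h2
    rw [Functor.map_comp, ← Category.assoc] at h1
    obtain ⟨s, hs⟩ := h.2 _ h1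
    refine ⟨s, ?_⟩
    rw [← Category.assoc, hs, Category.assoc, ← Functor.map_comp]
    have h3 : t = t ≫ (toFreyd C).map (biprod.fst ≫ biprod.inl + biprod.snd ≫ biprod.inr) := by
      rw [biprod.total, CategoryTheory.Functor.map_id, Category.comp_id]
    conv_rhs => rw [h3, Functor.map_add, Preadditive.comp_add, Functor.map_comp _ biprod.snd,
      reassoc_of% h2, zero_comp, add_zero]

/-- Given presentations of the objects of a diagram `Y` in the Freyd category as kernels of
morphisms `Eᵢ ⟶ Fᵢ` of `C`, the diagram `Y` consists of the kernels of the morphisms to the last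
object in a diagram `X` with entries in `C`. The object `Xᵢ` is `Eᵢ ⊞ Fᵢ₋₁ ⊞ ⋯ ⊞ F₀` and the last
object is the sum of all `Fᵢ`; the diagram is built by prepending one object at a time. -/
lemma exists_diagram_isWeakKernelOf {m : ℕ} (Y : Fin m ⥤ FreydCat C) (E F : Fin m → C)
    (ι : ∀ i, Y.obj i ⟶ (toFreyd C).obj (E i)) (hι : ∀ i, Mono (ι i)) (w : ∀ i, E i ⟶ F i)
    (hw : ∀ i, IsWeakKernelOf (ι i) ((toFreyd C).map (w i))) :
    ∃ (X : Fin (m + 1) ⥤ C) (κ : Y ⟶ Fin.castSuccFunctor m ⋙ X ⋙ toFreyd C),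
      (∀ i, Mono (κ.app i)) ∧
      (∀ i, IsWeakKernelOf (κ.app i) ((toFreyd C).map (toLast X i.castSucc))) ∧
      ((∀ i, IsZero (F i)) → IsZero (X.obj (Fin.last m))) := by
  induction m with
  | zero =>
    exact ⟨(Functor.const _).obj 0, { app := fun i => i.elim0, naturality := fun i => i.elim0 },
      fun i => i.elim0, fun i => i.elim0, fun _ => isZero_zero C⟩
  | succ m ih =>
    obtain ⟨X, κ, hκ, hX, hX0⟩ := ih (Fin.succFunctor m ⋙ Y) (fun i => E i.succ)
      (fun i => F i.succ) (fun i => ι i.succ) (fun i => hι i.succ) (fun i => w i.succ)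
      (fun i => hw i.succ)
    -- The morphism `Y₀ ⟶ Y₁ ⟶ X₀` extends to `E₀` by injectivity.
    obtain ⟨φ, hφ, hφ0⟩ : ∃ φ : E 0 ⟶ X.obj 0,
        (∀ i : Fin m, ι 0 ≫ (toFreyd C).map (φ ≫ X.map (homOfLE (Fin.zero_le i.castSucc))) =
          Y.map (homOfLE (Fin.zero_le i.succ)) ≫ κ.app i) ∧
        ι 0 ≫ (toFreyd C).map (φ ≫ toLast X 0) = 0 := by
      cases m with
      | zero => exact ⟨0, fun i => i.elim0, by simp⟩
      | succ m =>
        let g : Y.obj 0 ⟶ (toFreyd C).obj (X.obj 0) :=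
          Y.map (homOfLE (Fin.zero_le (Fin.succ 0))) ≫ κ.app 0
        have := hι 0
        let φ := (toFreyd C).preimage (Injective.factorThru g (ι 0))
        have hφ : ι 0 ≫ (toFreyd C).map φ = g := by
          rw [Functor.map_preimage, Injective.comp_factorThru]
        refine ⟨φ, fun i => ?_, ?_⟩
        · rw [Functor.map_comp, ← Category.assoc, hφ]
          refine (Category.assoc _ _ _).trans ?_
          have := κ.naturality (homOfLE (Fin.zero_le i))
          refine (congrArg (Y.map (homOfLE (Fin.zero_le (Fin.succ 0))) ≫ ·) this.symm).trans ?_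
          refine (Category.assoc _ _ _).symm.trans ?_
          exact congrArg (· ≫ κ.app i) (Y.map_comp _ _).symm
        · rw [Functor.map_comp, ← Category.assoc, hφ]
          refine (Category.assoc _ _ _).trans ?_
          exact (congrArg _ (hX 0).1).trans comp_zero
    let T : C ⥤ C := { obj := fun Z => Z ⊞ F 0, map := fun f => biprod.map f (𝟙 _) }
    let X₁ : ComposableArrows C m := X ⋙ T
    let f : E 0 ⟶ X₁.left := biprod.lift φ (w 0)
    have hT : ∀ {U V : C} (a : E 0 ⟶ U) (r : U ⟶ V),
        biprod.lift a (w 0) ≫ biprod.map r (𝟙 (F 0)) = biprod.lift (a ≫ r) (w 0) := by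
      intro U V a r
      ext <;> simp
    have hf : ∀ j : Fin (m + 1), f ≫ X₁.map (homOfLE (Fin.zero_le j)) =
        biprod.lift (φ ≫ X.map (homOfLE (Fin.zero_le j))) (w 0) := fun j => hT _ _
    refine ⟨X₁.precomp f,
      { app := Fin.cases (ι 0) fun i => κ.app i ≫ (toFreyd C).map biprod.inl
        naturality := ?_ }, ?_, ?_, fun h => ?_⟩
    · intro i j g
      induction i using Fin.cases with
      | zero =>
        induction j using Fin.cases with
        | zero =>
          exact (congrArg (· ≫ ι 0) (Y.map_id 0)).trans <| (Category.id_comp _).trans <|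
            (Category.comp_id _).symm.trans <| congrArg (ι 0 ≫ ·)
              (((X₁.precomp f) ⋙ toFreyd C).map_id 0).symm
        | succ j =>
          refine (Category.assoc _ _ _).symm.trans <|
            (congrArg (· ≫ (toFreyd C).map biprod.inl) (hφ j)).symm.trans <|
            (comp_toFreyd_map_biprod_lift _ _ _ (hw 0).1).symm.trans <|
            congrArg (fun z => ι 0 ≫ (toFreyd C).map z) ?_
          exact (hf j.castSucc).symm.trans (precomp_map_zero_succ X₁ f j.castSucc).symm
      | succ i =>
        induction j using Fin.cases with
        | zero => exact absurd (leOfHom g) (by simp)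
        | succ j =>
          have h1 := κ.naturality (homOfLE (Fin.succ_le_succ_iff.1 (leOfHom g)))
          have h2 : biprod.inl ≫ T.map (X.map (homOfLE
              (Fin.castSucc_le_castSucc_iff.2 (Fin.succ_le_succ_iff.1 (leOfHom g))))) =
              X.map _ ≫ biprod.inl := biprod.inl_map _ _
          refine (Category.assoc _ _ _).symm.trans <|
            (congrArg (· ≫ (toFreyd C).map biprod.inl) h1).trans <|
            (Category.assoc _ _ _).trans <| Eq.trans ?_ (Category.assoc _ _ _).symm
          refine congrArg (κ.app i ≫ ·) ?_
          exact ((toFreyd C).map_comp _ _).symm.trans <|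
            (congrArg (toFreyd C).map h2.symm).trans ((toFreyd C).map_comp _ _)
    · intro i
      induction i using Fin.cases with
      | zero => exact hι 0
      | succ i =>
        have := hκ i
        exact mono_comp (κ.app i) ((toFreyd C).map biprod.inl)
    · intro i
      induction i using Fin.cases with
      | zero =>
        have h0 : (X₁.precomp f).map (homOfLE (Fin.zero_le (Fin.last m).succ)) =
            biprod.lift (φ ≫ toLast X 0) (w 0) :=
          (precomp_map_zero_succ X₁ f (Fin.last m)).trans (hf (Fin.last m))
        have h1 := (hw 0).biprod_lift _ hφ0
        exact ⟨(congrArg (fun z => ι 0 ≫ (toFreyd C).map z) h0).trans h1.1, fun S t ht =>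
          h1.2 t ((congrArg (fun z => t ≫ (toFreyd C).map z) h0).symm.trans ht)⟩
      | succ i => exact (hX i).biprod_map_id (F 0)
    · have h1 := hX0 fun i => h i.succ
      refine (IsZero.iff_id_eq_zero _).2 (biprod.hom_ext _ _ ?_ ?_)
      · exact h1.eq_of_tgt _ _
      · exact (h 0).eq_of_tgt _ _

end Density

/-! ### The functor of kernels -/

section LastKernels

open scoped ZeroObject

variable {C : Type u} [Category.{v} C] [Preadditive C] [WeaklyAbelian C] {m : ℕ}

/-- The inclusion of the kernel of `Xᵢ ⟶ Xₘ` into `Xᵢ`. -/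
def lastKernelsι (X : Fin (m + 1) ⥤ C) (i : Fin m) :
    ((lastKernels C m).obj X).obj i ⟶ (toFreyd C).obj (X.obj i.castSucc) :=
  kernel.ι ((toFreyd C).map (toLast X i.castSucc))

instance (X : Fin (m + 1) ⥤ C) (i : Fin m) : Mono (lastKernelsι X i) :=
  inferInstanceAs (Mono (kernel.ι _))

lemma isWeakKernelOf_lastKernelsι (X : Fin (m + 1) ⥤ C) (i : Fin m) :
    IsWeakKernelOf (lastKernelsι X i) ((toFreyd C).map (toLast X i.castSucc)) :=
  ⟨kernel.condition _, fun _ t ht => ⟨kernel.lift _ t ht, kernel.lift_ι _ _ _⟩⟩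

lemma lastKernels_obj_map_ι (X : Fin (m + 1) ⥤ C) {i j : Fin m} (h : i ⟶ j) :
    ((lastKernels C m).obj X).map h ≫ lastKernelsι X j =
      lastKernelsι X i ≫ (toFreyd C).map
        (X.map (homOfLE (Fin.castSucc_le_castSucc_iff.2 (leOfHom h)))) :=
  kernel.lift_ι _ _ _

lemma lastKernels_map_app_ι {X Y : Fin (m + 1) ⥤ C} (f : X ⟶ Y) (i : Fin m) :
    ((lastKernels C m).map f).app i ≫ lastKernelsι Y i =
      lastKernelsι X i ≫ (toFreyd C).map (f.app i.castSucc) :=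
  kernel.lift_ι _ _ _

instance : (lastKernels C m).Additive := ⟨fun {X Y f g} => by
  ext i
  rw [← cancel_mono (lastKernelsι Y i), lastKernels_map_app_ι, NatTrans.app_add, NatTrans.app_add,
    Preadditive.add_comp, lastKernels_map_app_ι, lastKernels_map_app_ι, Functor.map_add,
    Preadditive.comp_add]⟩

lemma nonempty_lastKernels_iso {X : Fin (m + 1) ⥤ C} {Y : Fin m ⥤ FreydCat C}
    (κ : Y ⟶ Fin.castSuccFunctor m ⋙ X ⋙ toFreyd C) (hκ : ∀ i, Mono (κ.app i))
    (hX : ∀ i, IsWeakKernelOf (κ.app i) ((toFreyd C).map (toLast X i.castSucc))) :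
    Nonempty ((lastKernels C m).obj X ≅ Y) := by
  choose θ hθ using fun i => (isWeakKernelOf_lastKernelsι X i).2 (κ.app i) (hX i).1
  let Θ : Y ⟶ (lastKernels C m).obj X :=
    { app := θ
      naturality := fun i j h => by
        rw [← cancel_mono (lastKernelsι X j), Category.assoc, Category.assoc, hθ,
          lastKernels_obj_map_ι, ← Category.assoc, hθ]
        exact κ.naturality h }
  have : ∀ i, IsIso (Θ.app i) := fun i => by
    obtain ⟨s, hs⟩ := (hX i).2 (lastKernelsι X i) (isWeakKernelOf_lastKernelsι X i).1
    have hm : Mono (θ i) := by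
      have : Mono (θ i ≫ lastKernelsι X i) := by
        rw [hθ]
        exact hκ i
      exact mono_of_mono _ (lastKernelsι X i)
    have : IsSplitEpi (θ i) := IsSplitEpi.mk' ⟨s, by
      rw [← cancel_mono (lastKernelsι X i), Category.assoc, hθ]
      exact hs.trans (Category.id_comp _).symm⟩
    exact isIso_of_mono_of_isSplitEpi (θ i)
  have : IsIso Θ := NatIso.isIso_of_isIso_app Θ
  exact ⟨(asIso Θ).symm⟩

instance : (lastKernels C m).EssSurj := ⟨fun Y => by
  choose F w hw using fun i => FreydCat.exists_isWeakKernelOf_ι (Y.obj i)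
  obtain ⟨X, κ, hκ, hX, -⟩ := exists_diagram_isWeakKernelOf Y _ F
    (fun i => FreydCat.ι (Y.obj i)) (fun i => inferInstance) w hw
  exact ⟨X, nonempty_lastKernels_iso κ hκ hX⟩⟩

/-- A morphism between diagrams of kernels extends componentwise to a family `φ` of morphisms
`Xᵢ ⟶ Yᵢ`, by injectivity. The deviation of `φ` from naturality vanishes on the kernel of
`Xᵢ ⟶ Xₘ`, so it factors over `Xᵢ ⟶ Xₘ` and can be corrected. -/
instance : (lastKernels C m).Full := ⟨fun {X Y} g => by
  obtain ⟨φ, hφ⟩ : ∃ φ : ∀ i, X.obj i ⟶ Y.obj i, ∀ i : Fin m,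
      lastKernelsι X i ≫ (toFreyd C).map (φ i.castSucc) = g.app i ≫ lastKernelsι Y i := by
    let φ : ∀ i : Fin m, X.obj i.castSucc ⟶ Y.obj i.castSucc := fun i =>
      (toFreyd C).preimage (Injective.factorThru (g.app i ≫ lastKernelsι Y i) (lastKernelsι X i))
    refine ⟨Fin.lastCases 0 φ, fun i => ?_⟩
    beta_reduce
    rw [Fin.lastCases_castSucc, Functor.map_preimage, Injective.comp_factorThru]
  have hφ' : ∀ (i : Fin m) (j : Fin (m + 1)) (h : i.castSucc ⟶ j),
      lastKernelsι X i ≫ (toFreyd C).map (X.map h ≫ φ j) =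
        g.app i ≫ lastKernelsι Y i ≫ (toFreyd C).map (Y.map h) := by
    intro i j h
    rw [Functor.map_comp]
    obtain ⟨j, rfl⟩ | rfl := j.eq_castSucc_or_eq_last
    · let h' : i ⟶ j := homOfLE (Fin.castSucc_le_castSucc_iff.1 (leOfHom h))
      have hX := lastKernels_obj_map_ι X h'
      have hY := lastKernels_obj_map_ι Y h'
      refine (Category.assoc _ _ _).symm.trans ((congrArg (· ≫ _) hX.symm).trans ?_)
      refine Eq.trans ?_ (congrArg (g.app i ≫ ·) hY)
      rw [Category.assoc, hφ, g.naturality_assoc]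
    · exact (Category.assoc _ _ _).symm.trans <|
        (congrArg (· ≫ _) (isWeakKernelOf_lastKernelsι X i).1).trans <| zero_comp.trans <|
        (comp_zero.symm.trans (congrArg (g.app i ≫ ·) (isWeakKernelOf_lastKernelsι Y i).1.symm))
  obtain ⟨f, d, hf⟩ := exists_hom_app_eq_add φ fun i =>
    (isWeakKernelOf_lastKernelsι X i).exists_comp_eq
      (φ i.castSucc ≫ toSucc Y i - toSucc X i ≫ φ i.succ) (by
        rw [Functor.map_sub, Preadditive.comp_sub, hφ', Functor.map_comp, ← Category.assoc, hφ,
          Category.assoc, sub_self])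
  refine ⟨f, ?_⟩
  ext i
  rw [← cancel_mono (lastKernelsι Y i), lastKernels_map_app_ι, hf, Functor.map_add,
    Preadditive.comp_add, hφ, Functor.map_comp, ← Category.assoc,
    (isWeakKernelOf_lastKernelsι X i).1, zero_comp, add_zero]⟩

/-! ### Split diagrams -/

/-- A morphism of diagrams that vanishes on kernels factors over a split diagram. -/
lemma exists_factorization_of_lastKernels_map_eq_zero {X Y : Fin (m + 1) ⥤ C} (f : X ⟶ Y)
    (hf : (lastKernels C m).map f = 0) :
    ∃ (Z : Fin (m + 1) ⥤ C) (_ : splitDiagrams C (m + 1) Z) (a : X ⟶ Z) (b : Z ⟶ Y),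
      f = a ≫ b := by
  obtain ⟨Z, a, b, hab, hZ⟩ := exists_factorization_isSplitMono f fun i => by
    obtain ⟨i, rfl⟩ | rfl := i.eq_castSucc_or_eq_last
    · refine (isWeakKernelOf_lastKernelsι X i).exists_comp_eq (f.app i.castSucc) ?_
      rw [← lastKernels_map_app_ι, hf, NatTrans.app_zero, zero_comp]
    · exact ⟨f.app _, by rw [toLast_last, Category.id_comp]⟩
  refine ⟨Z, fun i j h => ?_, a, b, hab⟩
  have := hZ h
  exact IsSplitMorphism.of_isSplitMono _

/-- For a split diagram `Z`, the inclusions of the kernels of `Zᵢ ⟶ Zₘ` into `Zᵢ` have a natural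
retraction: subtract from the identity a compatible family of projections onto complements. So the
diagram of kernels is a direct summand of the split diagram `Z₀ ⟶ ⋯ ⟶ Zₘ₋₁`. -/
lemma exists_retract_of_splitDiagrams {Z : Fin (m + 1) ⥤ C} (hZ : splitDiagrams C (m + 1) Z) :
    ∃ (W : Fin m ⥤ FreydCat C) (_ : splitDiagramsInFreyd C m W)
      (a : (lastKernels C m).obj Z ⟶ W) (b : W ⟶ (lastKernels C m).obj Z), a ≫ b = 𝟙 _ := by
  obtain ⟨s, hs, hs'⟩ := exists_compatible_regular_inverse Z fun i => by
    obtain ⟨s, hs⟩ := (hZ (homOfLE (Fin.le_last i))).exists_comp_comp_eq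
    obtain ⟨s, rfl⟩ := (toFreyd C).map_surjective s
    exact ⟨s, (toFreyd C).map_injective (by simpa only [Functor.map_comp] using hs)⟩
  let e : Z ⟶ Z := linearHom (fun i => 𝟙 _ - toLast Z i ≫ s i) fun i => by
    rw [Preadditive.comp_sub, Preadditive.sub_comp, toSucc_toLast_assoc, Category.assoc, hs',
      Category.comp_id, Category.id_comp]
  have he : ∀ i, e.app i ≫ toLast Z i = 0 := fun i => by
    rw [linearHom_app, Preadditive.sub_comp, Category.assoc, hs, Category.id_comp, sub_self]
  choose b hb using fun i : Fin m => (isWeakKernelOf_lastKernelsι Z i).2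
    ((toFreyd C).map (e.app i.castSucc)) (by rw [← Functor.map_comp, he, Functor.map_zero])
  have hnat : ∀ {i j : Fin m} (h : i ⟶ j),
      (toFreyd C).map (Z.map (homOfLE (Fin.castSucc_le_castSucc_iff.2 (leOfHom h)))) ≫ b j =
        b i ≫ ((lastKernels C m).obj Z).map h := fun {i j} h => by
    rw [← cancel_mono (lastKernelsι Z j), Category.assoc, Category.assoc, hb,
      lastKernels_obj_map_ι, ← Category.assoc, hb, ← Functor.map_comp, ← Functor.map_comp,
      e.naturality]
  refine ⟨(Fin.castSuccFunctor m ⋙ Z) ⋙ toFreyd C,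
    ObjectProperty.prop_map_obj (splitDiagrams C m) ((Functor.whiskeringRight _ _ _).obj (toFreyd C))
      (X := Fin.castSuccFunctor m ⋙ Z) fun i j h => hZ _,
    { app := fun i => lastKernelsι Z i
      naturality := fun i j h => lastKernels_obj_map_ι Z h },
    { app := b
      naturality := fun i j h => hnat h }, ?_⟩
  ext i
  rw [← cancel_mono (lastKernelsι Z i)]
  refine (Category.assoc _ _ _).trans <| (congrArg (lastKernelsι Z i ≫ ·) (hb i)).trans ?_
  rw [linearHom_app, Functor.map_sub, Preadditive.comp_sub, Functor.map_comp, ← Category.assoc,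
    (isWeakKernelOf_lastKernelsι Z i).1, zero_comp, sub_zero]
  exact (congrArg (lastKernelsι Z i ≫ ·) ((toFreyd C).map_id _)).trans <|
    (Category.comp_id _).trans (Category.id_comp _).symm

/-- A split diagram `S₀ ⟶ ⋯ ⟶ Sₘ₋₁` is the diagram of kernels of the split diagram
`S₀ ⟶ ⋯ ⟶ Sₘ₋₁ ⟶ 0`. -/
lemma exists_splitDiagrams_lastKernels_iso {W : Fin m ⥤ FreydCat C}
    (hW : splitDiagramsInFreyd C m W) :
    ∃ (Z : Fin (m + 1) ⥤ C) (_ : splitDiagrams C (m + 1) Z),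
      Nonempty ((lastKernels C m).obj Z ≅ W) := by
  obtain ⟨S, hS, ⟨e⟩⟩ := (ObjectProperty.prop_map_iff _ _ _).1 hW
  obtain ⟨X, κ, hκ, hX, hX0⟩ := exists_diagram_isWeakKernelOf (S ⋙ toFreyd C) S.obj (fun _ => 0)
    (fun i => 𝟙 _) (fun i => inferInstance) (fun i => 0)
    (fun i => ⟨by simp, fun T t _ => ⟨t, Category.comp_id t⟩⟩)
  have hlast : IsZero (X.obj (Fin.last m)) := hX0 fun _ => isZero_zero C
  have hiso : ∀ i, IsIso (κ.app i) := fun i => by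
    have h0 : (toFreyd C).map (toLast X i.castSucc) = 0 := by
      rw [hlast.eq_of_tgt (toLast X i.castSucc) 0, Functor.map_zero]
    obtain ⟨s, hs⟩ := (hX i).2 (𝟙 _) ((Category.id_comp _).trans h0)
    have := hκ i
    have : IsSplitEpi (κ.app i) := IsSplitEpi.mk' ⟨s, hs⟩
    exact isIso_of_mono_of_isSplitEpi _
  let eκ : ∀ i, (S ⋙ toFreyd C).obj i ≅ (Fin.castSuccFunctor m ⋙ X ⋙ toFreyd C).obj i :=
    fun i => asIso (κ.app i)
  refine ⟨X, fun i j h => ?_, ?_⟩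
  · obtain ⟨j, rfl⟩ | rfl := j.eq_castSucc_or_eq_last
    · obtain ⟨i, rfl⟩ | rfl := i.eq_castSucc_or_eq_last
      · exact (hS (homOfLE (Fin.castSucc_le_castSucc_iff.1 (leOfHom h)))).of_arrow_iso
          (Arrow.isoMk (eκ i) (eκ j) (κ.naturality _).symm)
      · exact absurd (leOfHom h) (by simp)
    · exact IsSplitMorphism.of_isZero _ ((toFreyd C).map_isZero hlast)
  · obtain ⟨f⟩ := nonempty_lastKernels_iso κ hκ hX
    exact ⟨f ≪≫ e⟩

end LastKernels

end

theorem mainTheorem5 (C : Type u) [Category.{v} C] [Preadditive C] [WeaklyAbelian C] :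
    (∀ m : ℕ, 1 ≤ m →
      InducesEquivalence (lastKernels C m) (splitDiagrams C (m + 1)) (splitDiagramsInFreyd C m)) ∧
    InducesEquivalence
      (lastKernels C 1 ⋙ (evaluation (Fin 1) (FreydCat C)).obj 0 : (Fin 2 ⥤ C) ⥤ FreydCat C)
      (splitDiagrams C 2) (toFreyd C).essImage := by
  refine ⟨fun m _ => inducesEquivalence_of_full_of_essSurj _ _ _
    (fun X Y f hf => exists_factorization_of_lastKernels_map_eq_zero f hf)
    (fun Z hZ => exists_retract_of_splitDiagrams hZ)
    (fun W hW => exists_splitDiagrams_lastKernels_iso hW), ?_⟩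
  -- Diagrams on a single point are the same as objects.
  let ev : (Fin 1 ⥤ FreydCat C) ⥤ FreydCat C := (evaluation (Fin 1) (FreydCat C)).obj 0
  have hext : ∀ {X Y : Fin 1 ⥤ FreydCat C} {f g : X ⟶ Y}, f.app 0 = g.app 0 → f = g :=
    fun h => NatTrans.ext (funext fun i => by rwa [Subsingleton.elim i 0])
  have : ev.Full := ⟨fun {X Y} f =>
    ⟨linearHom (m := 0) (Fin.cases f fun i => i.elim0) fun i => i.elim0, rfl⟩⟩
  have : ev.EssSurj := ⟨fun W => ⟨(Functor.const _).obj W, ⟨Iso.refl _⟩⟩⟩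
  have : ev.Additive := ⟨rfl⟩
  refine inducesEquivalence_of_full_of_essSurj (lastKernels C 1 ⋙ ev) _ _
    (fun X Y f hf => exists_factorization_of_lastKernels_map_eq_zero f (hext hf))
    (fun Z hZ => ?_) (fun W hW => ?_)
  · obtain ⟨W, hW, a, b, hab⟩ := exists_retract_of_splitDiagrams hZ
    obtain ⟨S, -, ⟨e⟩⟩ := (ObjectProperty.prop_map_iff _ _ _).1 hW
    exact ⟨W.obj 0, ⟨S.obj 0, ⟨e.app 0⟩⟩, a.app 0, b.app 0, congrArg (fun f => f.app 0) hab⟩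
  · obtain ⟨S, ⟨e⟩⟩ := hW
    let S' : Fin 1 ⥤ C := (Functor.const _).obj S
    have hS' : splitDiagrams C 1 S' := fun i j h =>
      have : IsSplitMono ((toFreyd C).map (S'.map h)) :=
        inferInstanceAs (IsSplitMono ((toFreyd C).map (𝟙 S)))
      IsSplitMorphism.of_isSplitMono _
    obtain ⟨Z, hZ, ⟨f⟩⟩ := exists_splitDiagrams_lastKernels_iso
      (ObjectProperty.prop_map_obj (splitDiagrams C 1)
        ((Functor.whiskeringRight _ _ _).obj (toFreyd C)) hS')
    exact ⟨Z, hZ, ⟨ev.mapIso f ≪≫ e⟩⟩
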